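/- Let $H_n=1+\tfrac12+\dots+\tfrac1n$. The harmonic Euler sum $\sum_{n\ge1}H_n n^{-s}$, $\operatorname{Re}s>1$, has a unique meromorphic continuation $h$ to $\mathbb{C}$. Let $A_n$ ($n\ge 0$) be the Taylor coefficients at $0$ of $$\frac{ze^z}{e^z-1}\,\log\frac{e^z-1}{z}=\sum_{n\ge0}A_nz^n,$$ which is analytic at $0$ once given the value $0$ at $z=0$ (the logarithm is the principal one). Equivalently, $$A_n=\sum_{\substack{k+j=n\\ k\ge1,\ j\ge0}}\frac{B(k)}{k!\,k}\,\frac{B(j)}{j!},$$ where $B(k)=B_k$ are the Bernoulli numbers for $k\ne1$ and $B(1)=-B_1=\tfrac12$ (so $A_0=0$). Then for every integer $m\ge1$ the function $h$ is analytic at $-2m$ and $$(2m)!\,A_{2m+1}=h(-2m)-\zeta(1-2m)=\frac12\,B_{2m}\left(1+\frac1{2m}\right),$$ where $\zeta$ is the Riemann zeta function. -/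

import Mathlib

/-- `h` is the meromorphic continuation to the whole complex plane of the Euler sum
`∑_{n ≥ 1} H_n / n ^ s`, `Re s > 1`, where `H_n = 1 + 1/2 + ⋯ + 1/n`. The normal form condition
says that `h` is meromorphic on `ℂ`, takes its continuous value at every point that is not a pole,
and (by convention) takes the value `0` at the poles. -/
structure IsHarmonicEulerContinuation (h : ℂ → ℂ) : Prop where
  meromorphicNFOn : MeromorphicNFOn h Set.univ
  hasSum : ∀ s : ℂ, 1 < s.re → LSeriesHasSum (fun n : ℕ => ((harmonic n : ℚ) : ℂ)) s (h s)

/-- The analytically continued harmonic Euler sum: the function singled out by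
`IsHarmonicEulerContinuation`. -/
noncomputable def harmonicEulerSum : ℂ → ℂ :=
  Classical.epsilon IsHarmonicEulerContinuation

/-- The function `(z e^z / (e^z - 1)) log ((e^z - 1) / z)` near `0`, with its limit `0` as the
value at the removable singularity `z = 0`. -/
noncomputable def eulerGen (z : ℂ) : ℂ :=
  if z = 0 then 0
  else z * Complex.exp z / (Complex.exp z - 1) * Complex.log ((Complex.exp z - 1) / z)

/-- `A_n`, the `n`-th Taylor coefficient at `0` of `eulerGen`. -/
noncomputable def eulerCoeff (n : ℕ) : ℂ :=
  iteratedDeriv n eulerGen 0 / (n.factorial : ℂ)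

/-- The convolution `∑_{k + j = n, k ≥ 1, j ≥ 0} (B(k) / (k! k)) (B(j) / j!)` of Bernoulli numbers
with the convention `B(1) = 1/2`. -/
def bernoulliConvolution (n : ℕ) : ℚ :=
  ∑ k ∈ Finset.Icc 1 n,
    bernoulli' k / ((k.factorial : ℚ) * k) * (bernoulli' (n - k) / ((n - k).factorial : ℚ))

/-! For `Re s > 1`, `Γ(s) h(s)` is the Mellin transform of `G(t) = ∑ H_n e^{-nt} = -log(1 - e^{-t})
/ (1 - e^{-t})`. With `b(z) = z e^z / (e^z - 1)` and `E` = `eulerGen` one has `t G(t) = t b(t) -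
E(t) - b(t) log t` (`harmonicGen_eq`). Since `b` and `E` are analytic at `0`, `G` expands at `0` in
terms `t^(n-1) (c_n + d_n log t)`, where `d_n = -B(n)/n!` and `c_(n+1) = B(n)/n! - A_(n+1)`.

Subtracting finitely many terms continues the Mellin transform to the left; each term contributes
`c_n/(s+n-1) - d_n/(s+n-1)^2` (`hasMellin_logPowTerm`, `exists_analyticAt_mellinExtension_eq`). At
`s = -2m` the double pole is absent because `B(2m+1) = 0`, and the simple zero of `1/Γ` cancels the
simple pole, so `h(-2m) = (2m)! c_(2m+1) = B_(2m) - (2m)! A_(2m+1)`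
(`harmonicEulerSum_neg_two_mul`).

In the convolution for `A_(2m+1)` only `k = 1` and `k = 2m` survive, giving `(2m)! A_(2m+1) = (1/2)
B_(2m) (1 + 1/(2m))`. As `ζ(1-2m) = -B_(2m)/(2m)`, the difference `h(-2m) - ζ(1-2m)` is twice this
quantity minus itself. -/

/-! ### Taylor coefficients of the generating functions -/

/-- The Taylor series at `0`, as a formal power series. -/
noncomputable def taylorSeriesZero (f : ℂ → ℂ) : PowerSeries ℂ :=
  PowerSeries.mk fun n => iteratedDeriv n f 0 / (n.factorial : ℂ)

lemma coeff_taylorSeriesZero (f : ℂ → ℂ) (n : ℕ) :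
    PowerSeries.coeff n (taylorSeriesZero f) = iteratedDeriv n f 0 / (n.factorial : ℂ) :=
  PowerSeries.coeff_mk _ _

lemma taylorSeriesZero_mul {f g : ℂ → ℂ} (hf : AnalyticAt ℂ f 0) (hg : AnalyticAt ℂ g 0) :
    taylorSeriesZero (f * g) = taylorSeriesZero f * taylorSeriesZero g := by
  ext n
  rw [coeff_taylorSeriesZero, PowerSeries.coeff_mul, iteratedDeriv_mul hf.contDiffAt hg.contDiffAt,
    Finset.Nat.sum_antidiagonal_eq_sum_range_succ_mk, Finset.sum_div]
  refine Finset.sum_congr rfl fun i hi => ?_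
  have hi' : i ≤ n := Nat.lt_succ_iff.mp (Finset.mem_range.mp hi)
  rw [coeff_taylorSeriesZero, coeff_taylorSeriesZero, Nat.cast_choose ℂ hi']
  have h1 : (n.factorial : ℂ) ≠ 0 := by exact_mod_cast n.factorial_ne_zero
  have h2 : (i.factorial : ℂ) ≠ 0 := by exact_mod_cast i.factorial_ne_zero
  have h3 : ((n - i).factorial : ℂ) ≠ 0 := by exact_mod_cast (n - i).factorial_ne_zero
  field_simp

lemma iteratedDeriv_cexp_zero (n : ℕ) : iteratedDeriv n Complex.exp 0 = 1 := by
  rw [iteratedDeriv_eq_iterate, Complex.iter_deriv_exp, Complex.exp_zero]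

lemma taylorSeriesZero_exp : taylorSeriesZero Complex.exp = PowerSeries.exp ℂ := by
  ext n
  simp [coeff_taylorSeriesZero, iteratedDeriv_cexp_zero, PowerSeries.coeff_exp]

lemma taylorSeriesZero_exp_sub_one :
    taylorSeriesZero (fun z => Complex.exp z - 1) = PowerSeries.exp ℂ - 1 := by
  ext n
  rcases n with _ | n
  · simp [coeff_taylorSeriesZero]
  · have : deriv (fun z => Complex.exp z - 1) = Complex.exp := by
      ext z; simp
    simp [coeff_taylorSeriesZero, iteratedDeriv_succ', this, iteratedDeriv_cexp_zero,
      PowerSeries.coeff_exp, PowerSeries.coeff_one]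

lemma taylorSeriesZero_id : taylorSeriesZero (fun z => z) = PowerSeries.X := by
  ext n
  rcases n with _ | _ | n
  · simp [coeff_taylorSeriesZero]
  · simp [coeff_taylorSeriesZero]
  · have : deriv (fun z : ℂ => z) = fun _ => 1 := by ext z; simp
    rw [coeff_taylorSeriesZero, iteratedDeriv_succ', this, iteratedDeriv_succ', PowerSeries.coeff_X]
    simp

/-- The entire function `(e^z - 1) / z`. -/
noncomputable def expSlope : ℂ → ℂ := dslope Complex.exp 0

lemma expSlope_zero : expSlope 0 = 1 := by simp [expSlope]

lemma mul_expSlope (z : ℂ) : z * expSlope z = Complex.exp z - 1 := by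
  simpa [expSlope] using sub_smul_dslope Complex.exp 0 z

lemma expSlope_of_ne {z : ℂ} (hz : z ≠ 0) : expSlope z = (Complex.exp z - 1) / z := by
  rw [eq_div_iff hz, mul_comm, mul_expSlope]

lemma differentiable_expSlope : Differentiable ℂ expSlope := by
  rw [← differentiableOn_univ]
  exact (Complex.differentiableOn_dslope Filter.univ_mem).2
    Complex.differentiable_exp.differentiableOn

/-- The generating function `z e^z / (e^z - 1)` of the numbers `bernoulli'`. -/
noncomputable def bernoulliGen (z : ℂ) : ℂ := Complex.exp z / expSlope z

lemma analyticAt_expSlope (z : ℂ) : AnalyticAt ℂ expSlope z := differentiable_expSlope.analyticAt z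

lemma analyticAt_bernoulliGen : AnalyticAt ℂ bernoulliGen 0 :=
  analyticAt_cexp.div (analyticAt_expSlope 0) (by simp [expSlope_zero])

lemma analyticAt_log_expSlope : AnalyticAt ℂ (fun z => Complex.log (expSlope z)) 0 :=
  (analyticAt_expSlope 0).clog (by simp [expSlope_zero])

lemma eulerGen_eq : eulerGen = bernoulliGen * fun z => Complex.log (expSlope z) := by
  ext z
  by_cases hz : z = 0
  · simp [eulerGen, hz, expSlope_zero]
  · simp only [eulerGen, if_neg hz, bernoulliGen, Pi.mul_apply, expSlope_of_ne hz]
    rw [div_div_eq_mul_div, mul_comm z]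

lemma analyticAt_eulerGen : AnalyticAt ℂ eulerGen 0 := by
  rw [eulerGen_eq]
  exact analyticAt_bernoulliGen.mul analyticAt_log_expSlope

lemma eventually_expSlope_ne_zero : ∀ᶠ z in nhds (0 : ℂ), expSlope z ≠ 0 :=
  (analyticAt_expSlope 0).continuousAt.eventually_ne (by simp [expSlope_zero])

lemma taylorSeriesZero_congr {f g : ℂ → ℂ} (h : f =ᶠ[nhds 0] g) :
    taylorSeriesZero f = taylorSeriesZero g := by
  ext n
  rw [coeff_taylorSeriesZero, coeff_taylorSeriesZero, h.iteratedDeriv_eq]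

/-- Both series have the same product with `exp - 1`, which is nonzero and can be cancelled in the
domain of power series. -/
lemma taylorSeriesZero_bernoulliGen :
    taylorSeriesZero bernoulliGen = bernoulli'PowerSeries ℂ := by
  have hne : PowerSeries.exp ℂ - 1 ≠ 0 := by
    intro h
    simpa [PowerSeries.coeff_exp, PowerSeries.coeff_one] using congrArg (PowerSeries.coeff 1) h
  refine mul_right_cancel₀ hne ?_
  rw [bernoulli'PowerSeries_mul_exp_sub_one, ← taylorSeriesZero_exp_sub_one, ← taylorSeriesZero_id,
    ← taylorSeriesZero_exp, ← taylorSeriesZero_mul analyticAt_bernoulliGen (by fun_prop),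
    ← taylorSeriesZero_mul (by fun_prop) (by fun_prop)]
  refine taylorSeriesZero_congr ?_
  filter_upwards [eventually_expSlope_ne_zero] with z hz
  simp only [Pi.mul_apply, bernoulliGen, ← mul_expSlope]
  field_simp

lemma iteratedDeriv_bernoulliGen (n : ℕ) :
    iteratedDeriv n bernoulliGen 0 / (n.factorial : ℂ)
      = ((bernoulli' n / n.factorial : ℚ) : ℂ) := by
  rw [← coeff_taylorSeriesZero, taylorSeriesZero_bernoulliGen, bernoulli'PowerSeries,
    PowerSeries.coeff_mk]
  rfl

lemma taylorSeriesZero_X_mul_deriv {f : ℂ → ℂ} (hf : AnalyticAt ℂ f 0) (n : ℕ) :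
    PowerSeries.coeff n (taylorSeriesZero ((fun z => z) * deriv f))
      = n * PowerSeries.coeff n (taylorSeriesZero f) := by
  rw [taylorSeriesZero_mul (by fun_prop) hf.deriv, taylorSeriesZero_id]
  rcases n with _ | n
  · simp
  · rw [PowerSeries.coeff_succ_X_mul, coeff_taylorSeriesZero, coeff_taylorSeriesZero,
      iteratedDeriv_succ', Nat.factorial_succ]
    have : ((n + 1 : ℕ) : ℂ) ≠ 0 := by exact_mod_cast n.succ_ne_zero
    have h2 : (n.factorial : ℂ) ≠ 0 := by exact_mod_cast n.factorial_ne_zero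
    push_cast at this ⊢
    field_simp

/-- The operator `z d/dz` multiplies the `n`-th coefficient by `n` and sends `log ((e^z - 1)/z)` to
`b(z) - 1`. At `n = 0` both sides vanish, the right one by division by zero. -/
lemma coeff_taylorSeriesZero_log_expSlope (n : ℕ) :
    PowerSeries.coeff n (taylorSeriesZero fun z => Complex.log (expSlope z))
      = ((bernoulli' n / (n.factorial * n) : ℚ) : ℂ) := by
  rcases Nat.eq_zero_or_pos n with rfl | hn
  · simp [coeff_taylorSeriesZero, expSlope_zero]
  have hn' : (n : ℂ) ≠ 0 := by exact_mod_cast hn.ne'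
  refine mul_left_cancel₀ hn' ?_
  rw [← taylorSeriesZero_X_mul_deriv analyticAt_log_expSlope]
  have hev : ((fun z => z) * deriv fun z => Complex.log (expSlope z))
      =ᶠ[nhds 0] fun z => bernoulliGen z - 1 := by
    have hs : ∀ᶠ z in nhds (0 : ℂ), expSlope z ∈ Complex.slitPlane :=
      (analyticAt_expSlope 0).continuousAt.eventually_mem
        (Complex.isOpen_slitPlane.mem_nhds (by simp [expSlope_zero]))
    filter_upwards [hs] with z hz
    have hne := Complex.slitPlane_ne_zero hz
    have hd := (differentiable_expSlope z).hasDerivAt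
    have h1 : expSlope z + z * deriv expSlope z = Complex.exp z := by
      have h2 : HasDerivAt (fun w => w * expSlope w) (1 * expSlope z + z * deriv expSlope z) z :=
        (hasDerivAt_id z).mul hd
      have h3 : HasDerivAt (fun w => w * expSlope w) (Complex.exp z) z := by
        simp only [mul_expSlope]
        exact (Complex.hasDerivAt_exp z).sub_const 1
      simpa using h2.unique h3
    rw [Pi.mul_apply, (hd.clog hz).deriv, bernoulliGen, ← h1]
    field_simp
    ring
  rw [taylorSeriesZero_congr hev, coeff_taylorSeriesZero]
  have hsub : iteratedDeriv n (fun z => bernoulliGen z - 1) 0 = iteratedDeriv n bernoulliGen 0 := by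
    obtain ⟨k, rfl⟩ := Nat.exists_eq_succ_of_ne_zero hn.ne'
    have : deriv (fun z => bernoulliGen z - 1) = deriv bernoulliGen := by
      ext z; simp
    rw [Nat.succ_eq_add_one, iteratedDeriv_succ', iteratedDeriv_succ', this]
  rw [hsub, iteratedDeriv_bernoulliGen]
  push_cast
  field_simp

lemma eulerCoeff_eq (n : ℕ) : eulerCoeff n = (bernoulliConvolution n : ℂ) := by
  rw [eulerCoeff, ← coeff_taylorSeriesZero, eulerGen_eq, mul_comm,
    taylorSeriesZero_mul analyticAt_log_expSlope analyticAt_bernoulliGen, PowerSeries.coeff_mul,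
    Finset.Nat.sum_antidiagonal_eq_sum_range_succ_mk, bernoulliConvolution]
  simp only [coeff_taylorSeriesZero_log_expSlope]
  simp only [coeff_taylorSeriesZero, iteratedDeriv_bernoulliGen]
  -- The antidiagonal also contains `k = 0`; that term is `0` because its denominator `0! * 0` is
  -- zero.
  rw [Rat.cast_sum, Finset.sum_range_eq_add_Ico _ (Nat.succ_pos n)]
  simp only [Nat.cast_zero, mul_zero, div_zero, Rat.cast_zero, zero_mul, zero_add]
  refine Finset.sum_congr (by ext; simp) fun i _ => ?_
  push_cast
  rfl

/-! ### The Bernoulli convolution of odd index -/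

/-- One of `k` and `2m + 1 - k` is odd, so a nonzero term needs that index to be `1`. -/
lemma factorial_mul_bernoulliConvolution {m : ℕ} (hm : 1 ≤ m) :
    ((2 * m).factorial : ℚ) * bernoulliConvolution (2 * m + 1)
      = 1 / 2 * bernoulli (2 * m) * (1 + 1 / (2 * m)) := by
  have hz : ∀ k ∈ Finset.Icc 1 (2 * m + 1), k ∉ ({1, 2 * m} : Finset ℕ) →
      bernoulli' k / ((k.factorial : ℚ) * k)
        * (bernoulli' (2 * m + 1 - k) / ((2 * m + 1 - k).factorial : ℚ)) = 0 := by
    intro k hk hk'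
    simp only [Finset.mem_Icc, Finset.mem_insert, Finset.mem_singleton, not_or] at hk hk'
    rcases Nat.even_or_odd k with he | ho
    · have : bernoulli' (2 * m + 1 - k) = 0 :=
        bernoulli'_eq_zero_of_odd (by rw [Nat.odd_sub hk.2]; simp [he]) (by
          obtain ⟨r, rfl⟩ := he; omega)
      simp [this]
    · simp [bernoulli'_eq_zero_of_odd ho (by omega)]
  have hs : ({1, 2 * m} : Finset ℕ) ⊆ Finset.Icc 1 (2 * m + 1) := by
    intro k; simp only [Finset.mem_insert, Finset.mem_singleton, Finset.mem_Icc]; omega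
  rw [bernoulliConvolution, ← Finset.sum_subset hs hz, Finset.sum_pair (by omega),
    bernoulli_eq_bernoulli'_of_ne_one (by omega)]
  have h1 : 2 * m + 1 - 2 * m = 1 := by omega
  have h2 : ((2 * m).factorial : ℚ) ≠ 0 := by exact_mod_cast (2 * m).factorial_ne_zero
  have h3 : (m : ℚ) ≠ 0 := by exact_mod_cast (by omega : m ≠ 0)
  simp only [h1, Nat.add_sub_cancel, bernoulli'_one, Nat.factorial_one, Nat.cast_one]
  push_cast
  field_simp

/-! ### Mellin transforms of functions with a power-logarithm expansion -/

open Set Filter Topology Asymptotics MeasureTheory in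
lemma locallyIntegrableOn_indicator {f : ℝ → ℂ} {s t : Set ℝ} (h : LocallyIntegrableOn f s)
    (ht : MeasurableSet t) : LocallyIntegrableOn (t.indicator f) s := fun x hx => by
  obtain ⟨u, hu, hi⟩ := h x hx
  exact ⟨u, hu, hi.indicator ht⟩

/-- The function `t ^ (n - 1) (c + d log t)`, cut off outside `(0, 1]`. -/
noncomputable def logPowTerm (c d : ℂ) (n : ℕ) : ℝ → ℂ :=
  (Set.Ioc (0 : ℝ) 1).indicator fun t => (t : ℂ) ^ ((n : ℂ) - 1) * (c + Real.log t * d)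

section LogPowTerm

open Set Filter Topology Asymptotics MeasureTheory

lemma indicator_Ioc_eventuallyEq_zero (f : ℝ → ℂ) :
    (Ioc (0 : ℝ) 1).indicator f =ᶠ[atTop] fun _ => 0 := by
  filter_upwards [eventually_gt_atTop 1] with t ht
  exact indicator_of_notMem (fun h => absurd h.2 (not_le.2 ht)) _

lemma continuousOn_cpow_Ioi (a : ℂ) : ContinuousOn (fun t : ℝ => (t : ℂ) ^ a) (Ioi 0) :=
  fun t ht => (Complex.continuousAt_ofReal_cpow_const t a (Or.inr (ne_of_gt ht))).continuousWithinAt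

lemma locallyIntegrableOn_logPowTerm (c d : ℂ) (n : ℕ) :
    LocallyIntegrableOn (logPowTerm c d n) (Ioi 0) := by
  refine locallyIntegrableOn_indicator (ContinuousOn.locallyIntegrableOn ?_ measurableSet_Ioi)
    measurableSet_Ioc
  refine (continuousOn_cpow_Ioi _).mul (continuousOn_const.add (ContinuousOn.mul ?_ continuousOn_const))
  exact Complex.continuous_ofReal.comp_continuousOn
    (Real.continuousOn_log.mono fun t (ht : 0 < t) => ht.ne')

/-- A factor `log t` under the integral differentiates the transform in `s`, so the logarithmic part
comes from the derivative of `1/(s+n-1)`. -/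
lemma hasMellin_logPowTerm (c d : ℂ) (n : ℕ) {s : ℂ} (hs : 1 - n < s.re) :
    HasMellin (logPowTerm c d n) s (c / (s + n - 1) - d / (s + n - 1) ^ 2) := by
  have hconv : ∀ z : ℂ, 1 - n < z.re → HasMellin
      (indicator (Ioc 0 1) (fun t => (t : ℂ) ^ ((n : ℂ) - 1) : ℝ → ℂ)) z (1 / (z + n - 1)) := by
    intro z hz
    have := hasMellin_cpow_Ioc ((n : ℂ) - 1) (s := z) (by simp; linarith)
    rwa [← add_sub_assoc] at this
  set p : ℝ → ℂ := indicator (Ioc 0 1) (fun t => (t : ℂ) ^ ((n : ℂ) - 1) : ℝ → ℂ) with hp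
  have hne : s + n - 1 ≠ 0 := by
    intro h
    have := congrArg Complex.re h
    simp at this
    linarith
  have hlog := mellin_hasDerivAt_of_isBigO_rpow (f := p) (s := s) (a := s.re + 1) (b := 1 - n)
    (locallyIntegrableOn_indicator
      ((continuousOn_cpow_Ioi _).locallyIntegrableOn measurableSet_Ioi) measurableSet_Ioc)
    ((indicator_Ioc_eventuallyEq_zero _).trans_isBigO (isBigO_zero _ _)) (by linarith)
    (by
      refine IsBigO.of_bound 1 ?_
      filter_upwards [self_mem_nhdsWithin] with t (ht : 0 < t)
      rw [one_mul, hp]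
      refine (norm_indicator_le_norm_self _ _).trans ?_
      rw [Complex.norm_cpow_eq_rpow_re_of_pos ht, Real.norm_of_nonneg (by positivity)]
      simp) hs
  have hder : HasDerivAt (mellin p) (-1 / (s + n - 1) ^ 2) s := by
    have h1 : HasDerivAt (fun z : ℂ => 1 / (z + n - 1)) (-1 / (s + n - 1) ^ 2) s := by
      have h2 : HasDerivAt (fun z : ℂ => z + n - 1) 1 s :=
        ((hasDerivAt_id s).add_const _).sub_const _
      simp only [one_div]
      exact h2.inv hne
    refine h1.congr_of_eventuallyEq ?_
    have hopen : {z : ℂ | 1 - (n : ℝ) < z.re} ∈ 𝓝 s :=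
      (isOpen_lt continuous_const Complex.continuous_re).mem_nhds hs
    filter_upwards [hopen] with z hz
    exact (hconv z hz).2
  have h := hasMellin_add (f := fun t => c • p t) (g := fun t => d • (Real.log t • p t))
    ((hconv s hs).1.const_smul c) (hlog.1.const_smul d)
  have heq : logPowTerm c d n = fun t => c • p t + d • (Real.log t • p t) := by
    ext t
    by_cases ht : t ∈ Ioc (0 : ℝ) 1
    · simp only [logPowTerm, hp, indicator_of_mem ht, smul_eq_mul, Complex.real_smul]
      ring
    · simp [logPowTerm, hp, indicator_of_notMem ht]
  rw [heq]
  refine ⟨h.1, h.2.trans ?_⟩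
  rw [mellin_const_smul, mellin_const_smul, (hconv s hs).2, hlog.2.unique hder]
  simp only [smul_eq_mul]
  ring

end LogPowTerm

/-- The remainder of order `N` of `F` with respect to the expansion
`∑ t ^ (n - 1) (c n + d n log t)`. -/
noncomputable def logPowRemainder (F : ℝ → ℂ) (c d : ℕ → ℂ) (N : ℕ) (t : ℝ) : ℂ :=
  F t - ∑ n ∈ Finset.range N, logPowTerm (c n) (d n) n t

/-- `F` decays rapidly at infinity and has the asymptotic expansion
`∑ t ^ (n - 1) (c n + d n log t)` at `0`. -/
structure HasLogPowExpansion (F : ℝ → ℂ) (c d : ℕ → ℂ) : Prop where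
  locallyIntegrableOn : MeasureTheory.LocallyIntegrableOn F (Set.Ioi 0)
  isBigO_atTop : ∀ a : ℝ, F =O[Filter.atTop] fun t : ℝ => t ^ (-a)
  isBigO_zero : ∀ N : ℕ,
    logPowRemainder F c d N =O[nhdsWithin 0 (Set.Ioi 0)] fun t : ℝ => t ^ (-(2 - (N : ℝ)))

/-- The continuation of the Mellin transform of `F` to `2 - N < Re s`. -/
noncomputable def mellinContinuation (F : ℝ → ℂ) (c d : ℕ → ℂ) (N : ℕ) (s : ℂ) : ℂ :=
  mellin (logPowRemainder F c d N) s
    + ∑ n ∈ Finset.range N, (c n / (s + n - 1) - d n / (s + n - 1) ^ 2)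

/-- The meromorphic continuation of the Mellin transform of `F` to the plane. -/
noncomputable def mellinExtension (F : ℝ → ℂ) (c d : ℕ → ℂ) (s : ℂ) : ℂ :=
  -- This order `N` satisfies `2 - N < Re s`; any other such order gives the same value.
  mellinContinuation F c d (⌊2 - s.re⌋₊ + 1) s

namespace HasLogPowExpansion

open Set Filter Topology Asymptotics MeasureTheory

variable {F : ℝ → ℂ} {c d : ℕ → ℂ}

lemma locallyIntegrableOn_remainder (h : HasLogPowExpansion F c d) (N : ℕ) :
    LocallyIntegrableOn (logPowRemainder F c d N) (Ioi 0) := by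
  induction N with
  | zero =>
    have : logPowRemainder F c d 0 = F := by ext t; simp [logPowRemainder]
    rw [this]
    exact h.locallyIntegrableOn
  | succ N ih =>
    have : logPowRemainder F c d (N + 1)
        = logPowRemainder F c d N - logPowTerm (c N) (d N) N := by
      ext t
      simp only [logPowRemainder, Finset.sum_range_succ, Pi.sub_apply]
      ring
    rw [this]
    exact ih.sub (locallyIntegrableOn_logPowTerm _ _ _)

lemma isBigO_remainder_atTop (h : HasLogPowExpansion F c d) (N : ℕ) (a : ℝ) :
    logPowRemainder F c d N =O[atTop] fun t : ℝ => t ^ (-a) := by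
  refine (h.isBigO_atTop a).congr' ?_ EventuallyEq.rfl
  filter_upwards [eventually_gt_atTop 1] with t ht
  rw [logPowRemainder, Finset.sum_eq_zero, sub_zero]
  intro n _
  exact indicator_of_notMem (fun h => absurd h.2 (not_le.2 ht)) _

lemma mellinConvergent_remainder (h : HasLogPowExpansion F c d) (N : ℕ) {s : ℂ}
    (hs : 2 - N < s.re) : MellinConvergent (logPowRemainder F c d N) s :=
  mellinConvergent_of_isBigO_rpow (h.locallyIntegrableOn_remainder N)
    (h.isBigO_remainder_atTop N (s.re + 1)) (by linarith) (h.isBigO_zero N) hs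

lemma differentiableAt_mellin_remainder (h : HasLogPowExpansion F c d) (N : ℕ) {s : ℂ}
    (hs : 2 - N < s.re) : DifferentiableAt ℂ (mellin (logPowRemainder F c d N)) s :=
  mellin_differentiableAt_of_isBigO_rpow (h.locallyIntegrableOn_remainder N)
    (h.isBigO_remainder_atTop N (s.re + 1)) (by linarith) (h.isBigO_zero N) hs

lemma analyticAt_mellin_remainder (h : HasLogPowExpansion F c d) (N : ℕ) {s : ℂ}
    (hs : 2 - N < s.re) : AnalyticAt ℂ (mellin (logPowRemainder F c d N)) s := by
  have hopen : IsOpen {z : ℂ | 2 - (N : ℝ) < z.re} :=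
    isOpen_lt continuous_const Complex.continuous_re
  exact DifferentiableOn.analyticAt (fun z hz =>
    (h.differentiableAt_mellin_remainder N hz).differentiableWithinAt) (hopen.mem_nhds hs)

/-- The term removed from the remainder has as its Mellin transform exactly the rational function
added to the sum. -/
lemma mellinContinuation_succ (h : HasLogPowExpansion F c d) (N : ℕ) {s : ℂ}
    (hs : 2 - N < s.re) :
    mellinContinuation F c d (N + 1) s = mellinContinuation F c d N s := by
  have ht := hasMellin_logPowTerm (c N) (d N) N (s := s) (by linarith)
  have hsub := hasMellin_sub (h.mellinConvergent_remainder N hs) ht.1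
  have : logPowRemainder F c d (N + 1)
      = fun t => logPowRemainder F c d N t - logPowTerm (c N) (d N) N t := by
    ext t
    simp only [logPowRemainder, Finset.sum_range_succ]
    ring
  rw [mellinContinuation, mellinContinuation, this, hsub.2, ht.2, Finset.sum_range_succ]
  ring

lemma mellinContinuation_eq_of_le (h : HasLogPowExpansion F c d) {N M : ℕ} (hNM : N ≤ M) {s : ℂ}
    (hs : 2 - N < s.re) : mellinContinuation F c d M s = mellinContinuation F c d N s := by
  induction M, hNM using Nat.le_induction with
  | base => rfl
  | succ M hM ih =>
    have : (N : ℝ) ≤ M := by exact_mod_cast hM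
    rw [h.mellinContinuation_succ M (by linarith), ih]

lemma mellinExtension_eq (h : HasLogPowExpansion F c d) (N : ℕ) {s : ℂ} (hs : 2 - N < s.re) :
    mellinExtension F c d s = mellinContinuation F c d N s := by
  have h1 := Nat.lt_floor_add_one (2 - s.re)
  rcases le_total N (⌊2 - s.re⌋₊ + 1) with hle | hle
  · exact h.mellinContinuation_eq_of_le hle hs
  · exact (h.mellinContinuation_eq_of_le hle (by push_cast; linarith)).symm

lemma mellin_eq_mellinExtension (h : HasLogPowExpansion F c d) {s : ℂ} (hs : 1 < s.re) :
    mellin F s = mellinExtension F c d s := by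
  have hs1 : 2 - ((1 : ℕ) : ℝ) < s.re := by push_cast; linarith
  have ht := hasMellin_logPowTerm (c 0) (d 0) 0 (s := s) (by push_cast; linarith)
  have hadd := hasMellin_add (h.mellinConvergent_remainder 1 hs1) ht.1
  have : F = fun t => logPowRemainder F c d 1 t + logPowTerm (c 0) (d 0) 0 t := by
    ext t; simp [logPowRemainder]
  rw [h.mellinExtension_eq 1 hs1, mellinContinuation, Finset.sum_range_one, ← ht.2, ← hadd.2,
    ← this]

lemma eventually_mellinExtension_eq (h : HasLogPowExpansion F c d) (N : ℕ) {s : ℂ}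
    (hs : 2 - N < s.re) : mellinExtension F c d =ᶠ[𝓝 s] mellinContinuation F c d N := by
  have hopen : IsOpen {z : ℂ | 2 - (N : ℝ) < z.re} :=
    isOpen_lt continuous_const Complex.continuous_re
  filter_upwards [hopen.mem_nhds hs] with z hz
  exact h.mellinExtension_eq N hz

lemma meromorphicAt_mellinExtension (h : HasLogPowExpansion F c d) (s : ℂ) :
    MeromorphicAt (mellinExtension F c d) s := by
  have hs : 2 - ((⌊2 - s.re⌋₊ + 1 : ℕ) : ℝ) < s.re := by
    have h1 := Nat.lt_floor_add_one (2 - s.re)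
    push_cast; linarith
  refine MeromorphicAt.congr ?_ ((h.eventually_mellinExtension_eq _ hs).symm.filter_mono
    nhdsWithin_le_nhds)
  refine (h.analyticAt_mellin_remainder _ hs).meromorphicAt.add ?_
  refine MeromorphicAt.fun_sum fun n => ?_
  fun_prop

/-- The principal part of the continued Mellin transform at `-k`. -/
lemma exists_analyticAt_mellinExtension_eq (h : HasLogPowExpansion F c d) (k : ℕ) :
    ∃ g : ℂ → ℂ, AnalyticAt ℂ g (-(k : ℂ)) ∧ ∀ᶠ s in 𝓝 (-(k : ℂ)),
      mellinExtension F c d s = g s + c (k + 1) / (s + k) - d (k + 1) / (s + k) ^ 2 := by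
  -- `k + 3` is the least order whose half-plane `2 - N < Re s` contains `-k`.
  have hs : 2 - ((k + 3 : ℕ) : ℝ) < (-(k : ℂ)).re := by
    simp; linarith
  refine ⟨fun s => mellin (logPowRemainder F c d (k + 3)) s
    + ∑ n ∈ (Finset.range (k + 3)).erase (k + 1), (c n / (s + n - 1) - d n / (s + n - 1) ^ 2),
    (h.analyticAt_mellin_remainder _ hs).add ?_, ?_⟩
  · refine Finset.analyticAt_fun_sum _ fun n hn => ?_
    have hne : -(k : ℂ) + n - 1 ≠ 0 := by
      intro h0
      have h1 : (n : ℂ) = ((k + 1 : ℕ) : ℂ) := by push_cast; linear_combination h0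
      exact (Finset.mem_erase.1 hn).1 (by exact_mod_cast h1)
    refine AnalyticAt.sub (AnalyticAt.div (by fun_prop) (by fun_prop) hne)
      (AnalyticAt.div (by fun_prop) (by fun_prop) (pow_ne_zero 2 hne))
  · filter_upwards [h.eventually_mellinExtension_eq _ hs] with s hs'
    rw [hs', mellinContinuation, ← Finset.sum_erase_add _ _
      (Finset.mem_range.2 (by omega : k + 1 < k + 3))]
    have : s + ((k + 1 : ℕ) : ℂ) - 1 = s + k := by push_cast; ring
    rw [this]
    ring

end HasLogPowExpansion

/-! ### From Taylor series to the expansion at `0` -/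

section Expansion

open Set Filter Topology Asymptotics MeasureTheory

lemma isBigO_sub_taylor {φ : ℂ → ℂ} (hφ : AnalyticAt ℂ φ 0) (N : ℕ) :
    (fun t : ℝ => φ t - ∑ n ∈ Finset.range N,
        PowerSeries.coeff n (taylorSeriesZero φ) * (t : ℂ) ^ n) =O[𝓝[>] 0]
      fun t : ℝ => t ^ (N : ℝ) := by
  have h := hφ.hasFPowerSeriesAt.isBigO_sub_partialSum_pow N
  have ht : Tendsto (fun t : ℝ => (t : ℂ)) (𝓝[>] 0) (𝓝 0) :=
    (Complex.continuous_ofReal.tendsto' 0 0 (by simp)).mono_left nhdsWithin_le_nhds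
  refine (h.comp_tendsto ht).congr' (Eventually.of_forall fun t => ?_) ?_
  · simp [FormalMultilinearSeries.partialSum, coeff_taylorSeriesZero, mul_comm]
  · filter_upwards [self_mem_nhdsWithin] with t (ht : 0 < t)
    simp [abs_of_pos ht]

lemma isBigO_log_rpow_neg_one :
    (fun t : ℝ => (Real.log t : ℂ)) =O[𝓝[>] 0] fun t : ℝ => t ^ (-1 : ℝ) := by
  have h := (isLittleO_log_rpow_nhdsGT_zero (r := -1) (by norm_num)).isBigO
  exact IsBigO.of_norm_left (h.norm_left.congr_left fun t => by simp)

/-- The Taylor remainders are `O(t^N)`, the prefactor costs `t^(-1)`, and the crude bound `log t =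
O(t^(-1))` costs another power: hence the exponent `N - 2`. -/
lemma isBigO_logPowRemainder {F : ℝ → ℂ} {φ ψ : ℂ → ℂ} (hφ : AnalyticAt ℂ φ 0)
    (hψ : AnalyticAt ℂ ψ 0)
    (hF : ∀ t : ℝ, 0 < t → F t = (t : ℂ)⁻¹ * (φ t + Real.log t * ψ t)) (N : ℕ) :
    logPowRemainder F (fun n => PowerSeries.coeff n (taylorSeriesZero φ))
        (fun n => PowerSeries.coeff n (taylorSeriesZero ψ)) N
      =O[𝓝[>] 0] fun t : ℝ => t ^ (-(2 - (N : ℝ))) := by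
  have hinv : (fun t : ℝ => (t : ℂ)⁻¹) =O[𝓝[>] 0] fun t : ℝ => t ^ (-1 : ℝ) := by
    refine IsBigO.of_bound 1 ?_
    filter_upwards [self_mem_nhdsWithin] with t (ht : 0 < t)
    simp [Real.rpow_neg_one]
  have hφ' : (fun t : ℝ => φ t - ∑ n ∈ Finset.range N,
      PowerSeries.coeff n (taylorSeriesZero φ) * (t : ℂ) ^ n) =O[𝓝[>] 0]
      fun t : ℝ => t ^ (-1 : ℝ) * t ^ (N : ℝ) := by
    refine (isBigO_sub_taylor hφ N).trans (IsBigO.of_bound 1 ?_)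
    filter_upwards [Ioc_mem_nhdsGT (zero_lt_one (α := ℝ))] with t ht
    rw [norm_mul, one_mul]
    refine le_mul_of_one_le_left (norm_nonneg _) ?_
    rw [Real.norm_of_nonneg (Real.rpow_nonneg ht.1.le _), Real.rpow_neg_one]
    exact (one_le_inv₀ ht.1).2 ht.2
  have hψ' := isBigO_log_rpow_neg_one.mul (isBigO_sub_taylor hψ N)
  refine (hinv.mul (hφ'.add hψ')).congr' ?_ ?_
  · filter_upwards [Ioc_mem_nhdsGT (zero_lt_one (α := ℝ))] with t ht
    have ht0 : (t : ℂ) ≠ 0 := by exact_mod_cast ht.1.ne'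
    have hterm : ∀ n : ℕ, logPowTerm (PowerSeries.coeff n (taylorSeriesZero φ))
        (PowerSeries.coeff n (taylorSeriesZero ψ)) n t
        = (t : ℂ)⁻¹ * (PowerSeries.coeff n (taylorSeriesZero φ) * (t : ℂ) ^ n
          + Real.log t * (PowerSeries.coeff n (taylorSeriesZero ψ) * (t : ℂ) ^ n)) := by
      intro n
      rw [logPowTerm, indicator_of_mem ht, Complex.cpow_sub _ _ ht0, Complex.cpow_natCast,
        Complex.cpow_one]
      field_simp
    rw [logPowRemainder, hF t ht.1, Finset.sum_congr rfl fun n _ => hterm n, ← Finset.mul_sum,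
      Finset.sum_add_distrib, ← Finset.mul_sum]
    ring
  · filter_upwards [self_mem_nhdsWithin] with t (ht : 0 < t)
    rw [← Real.rpow_add ht, ← Real.rpow_add ht]
    congr 1
    ring

end Expansion

/-! ### The harmonic generating function and its Mellin transform -/

/-- The generating function `∑ H_n e^{-nt}` of the harmonic numbers. -/
noncomputable def harmonicGen (t : ℝ) : ℝ :=
  -Real.log (1 - Real.exp (-t)) / (1 - Real.exp (-t))

/-- Cauchy product of the series of `-log(1-x)` and `1/(1-x)`. -/
lemma hasSum_harmonic_mul_pow {x : ℝ} (hx0 : 0 ≤ x) (hx1 : x < 1) :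
    HasSum (fun n : ℕ => (harmonic n : ℝ) * x ^ n) (-Real.log (1 - x) / (1 - x)) := by
  have habs : |x| < 1 := by rwa [abs_of_nonneg hx0]
  have h1 := Real.hasSum_pow_div_log_of_abs_lt_one habs
  have h2 := hasSum_geometric_of_lt_one hx0 hx1
  have h := hasSum_sum_range_mul_of_summable_norm h1.summable.norm h2.summable.norm
  rw [h1.tsum_eq, h2.tsum_eq, ← div_eq_mul_inv] at h
  rw [← hasSum_nat_add_iff' 1]
  simp only [Finset.sum_range_one, harmonic_zero, Rat.cast_zero, zero_mul, sub_zero]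
  refine h.congr_fun fun n => ?_
  rw [harmonic, Rat.cast_sum, Finset.sum_mul]
  refine Finset.sum_congr rfl fun k hk => ?_
  have hk' : k ≤ n := Nat.lt_succ_iff.mp (Finset.mem_range.mp hk)
  have hp : x ^ (n + 1) = x ^ (k + 1) * x ^ (n - k) := by
    rw [← pow_add]; congr 1; omega
  rw [hp]
  push_cast
  ring

lemma hasSum_harmonicGen {t : ℝ} (ht : 0 < t) :
    HasSum (fun n : ℕ => (harmonic n : ℝ) * Real.exp (-n * t)) (harmonicGen t) := by
  have h := hasSum_harmonic_mul_pow (Real.exp_pos (-t)).le (by simpa using ht)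
  refine h.congr_fun fun n => ?_
  rw [← Real.exp_nat_mul]
  ring_nf

/-- `H_n ≤ 1 + log n = O(n^(x-1))` for any `x` with `1 < x < Re s`. -/
lemma LSeriesSummable_harmonic {s : ℂ} (hs : 1 < s.re) :
    LSeriesSummable (fun n : ℕ => ((harmonic n : ℚ) : ℂ)) s := by
  obtain ⟨x, hx1, hx2⟩ := exists_between hs
  refine LSeriesSummable_of_isBigO_rpow hx2 ?_
  have hlog : (fun n : ℕ => 1 + Real.log n) =O[Filter.atTop] fun n : ℕ => (n : ℝ) ^ (x - 1) := by
    have h1 : (fun y : ℝ => 1 + Real.log y) =O[Filter.atTop] fun y : ℝ => y ^ (x - 1) :=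
      ((Asymptotics.isLittleO_const_left.2 (Or.inr (tendsto_norm_atTop_atTop.comp
        (tendsto_rpow_atTop (by linarith))))).add
          (isLittleO_log_rpow_atTop (by linarith))).isBigO
    exact h1.comp_tendsto tendsto_natCast_atTop_atTop
  refine Asymptotics.IsBigO.trans (Asymptotics.IsBigO.of_bound 1 (Filter.Eventually.of_forall
    fun n => ?_)) hlog
  have h0 : (0 : ℝ) ≤ (harmonic n : ℝ) := by
    exact_mod_cast Finset.sum_nonneg (fun i _ => by positivity)
  have h2 : ‖((harmonic n : ℚ) : ℂ)‖ = (harmonic n : ℝ) := by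
    rw [← Complex.ofReal_ratCast, Complex.norm_real, Real.norm_of_nonneg h0]
  rw [h2, one_mul]
  exact (harmonic_le_one_add_log n).trans (le_abs_self _)

lemma hasSum_mellin_harmonicGen {s : ℂ} (hs : 1 < s.re) :
    LSeriesHasSum (fun n : ℕ => ((harmonic n : ℚ) : ℂ)) s
      ((Complex.Gamma s)⁻¹ * mellin (fun t => (harmonicGen t : ℂ)) s) := by
  have hsum := LSeriesSummable_harmonic hs
  have hs0 : s ≠ 0 := by rintro rfl; simp at hs; linarith
  have hterm : ∀ n : ℕ, LSeries.term (fun n : ℕ => ((harmonic n : ℚ) : ℂ)) s n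
      = ((harmonic n : ℚ) : ℂ) / ((n : ℝ) : ℂ) ^ s := by
    intro n
    rw [LSeries.term_def]
    rcases Nat.eq_zero_or_pos n with rfl | hn
    · simp
    · simp [hn.ne']
  have h := hasSum_mellin (a := fun n : ℕ => ((harmonic n : ℚ) : ℂ)) (p := fun n => (n : ℝ))
    (F := fun t => (harmonicGen t : ℂ)) (s := s) (fun n => by
      rcases Nat.eq_zero_or_pos n with rfl | hn
      · simp
      · right; exact_mod_cast hn) (by linarith)
    (fun t ht => by
      have := Complex.hasSum_ofReal.2 (hasSum_harmonicGen ht)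
      simpa using this)
    (by
      refine hsum.norm.congr fun n => ?_
      rw [hterm, norm_div]
      rcases Nat.eq_zero_or_pos n with rfl | hn
      · simp
      · congr 1
        exact Complex.norm_cpow_eq_rpow_re_of_pos (by exact_mod_cast hn) s)
  have h' := h.mul_left (Complex.Gamma s)⁻¹
  have hG : Complex.Gamma s ≠ 0 := Complex.Gamma_ne_zero_of_re_pos (by linarith)
  refine h'.congr_fun fun n => ?_
  rw [hterm]
  field_simp

lemma harmonicGen_eq {t : ℝ} (ht : 0 < t) :
    (harmonicGen t : ℂ) = (t : ℂ)⁻¹ * ((t * bernoulliGen t - eulerGen t)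
      + Real.log t * (-bernoulliGen t)) := by
  have ht0 : (t : ℂ) ≠ 0 := by exact_mod_cast ht.ne'
  have he : 0 < Real.exp t - 1 := by simpa using ht
  have hslope : expSlope t = (((Real.exp t - 1) / t : ℝ) : ℂ) := by
    rw [expSlope_of_ne ht0]; push_cast; rfl
  have hb : bernoulliGen t = ((Real.exp t * t / (Real.exp t - 1) : ℝ) : ℂ) := by
    rw [bernoulliGen, hslope, ← div_div_eq_mul_div]; push_cast; rfl
  have hneg : 1 - Real.exp (-t) = (Real.exp t - 1) / Real.exp t := by
    rw [Real.exp_neg]; field_simp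
  rw [eulerGen_eq, Pi.mul_apply, hslope, hb, ← Complex.ofReal_log (by positivity), harmonicGen,
    hneg, Real.log_div he.ne' (Real.exp_pos t).ne', Real.log_div he.ne' ht.ne', Real.log_exp]
  have := he.ne'
  norm_cast
  field_simp
  ring

lemma continuousOn_harmonicGen : ContinuousOn harmonicGen (Set.Ioi 0) := by
  have hne : ∀ t ∈ Set.Ioi (0 : ℝ), 1 - Real.exp (-t) ≠ 0 := by
    intro t (ht : 0 < t)
    have : Real.exp (-t) < 1 := by simpa using ht
    linarith
  exact ((ContinuousOn.log (by fun_prop) hne).neg).div (by fun_prop) hne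

/-- `-log(1-x)/(1-x)` is differentiable at `0` and vanishes there, hence is `O(x)`; then put `x =
e^{-t}`. -/
lemma isBigO_harmonicGen_atTop :
    harmonicGen =O[Filter.atTop] fun t : ℝ => Real.exp (-1 * t) := by
  have htend : Filter.Tendsto (fun t : ℝ => Real.exp (-t)) Filter.atTop (nhds 0) :=
    Real.tendsto_exp_neg_atTop_nhds_zero
  have hd : HasDerivAt (fun x : ℝ => -Real.log (1 - x) / (1 - x))
      ((-((0 - 1) / (1 - 0)) * (1 - 0) - -Real.log (1 - 0) * (0 - 1)) / (1 - 0) ^ 2) 0 := by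
    have h1 : HasDerivAt (fun x : ℝ => 1 - x) (0 - 1) 0 :=
      (hasDerivAt_const _ _).sub (hasDerivAt_id 0)
    exact (h1.log (by norm_num)).fun_neg.div h1 (by norm_num)
  have h := hd.isBigO_sub.comp_tendsto htend
  refine h.congr (fun t => ?_) fun t => ?_
  · simp [harmonicGen]
  · simp

/-- The coefficients of `t ^ (n - 1)` in the expansion of `∑ H_n e^{-nt}` at `0`. -/
noncomputable def harmonicCoeff (n : ℕ) : ℂ :=
  PowerSeries.coeff n (taylorSeriesZero fun z => z * bernoulliGen z - eulerGen z)

/-- The coefficients of `t ^ (n - 1) log t` in the expansion of `∑ H_n e^{-nt}` at `0`. -/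
noncomputable def harmonicLogCoeff (n : ℕ) : ℂ :=
  PowerSeries.coeff n (taylorSeriesZero fun z => -bernoulliGen z)

lemma harmonicCoeff_succ (n : ℕ) :
    harmonicCoeff (n + 1) = ((bernoulli' n / n.factorial : ℚ) : ℂ) - eulerCoeff (n + 1) := by
  have hz : AnalyticAt ℂ ((fun z => z) * bernoulliGen) 0 :=
    AnalyticAt.mul (by fun_prop) analyticAt_bernoulliGen
  have h : (fun z => z * bernoulliGen z - eulerGen z) = (fun z => z) * bernoulliGen - eulerGen := rfl
  rw [harmonicCoeff, coeff_taylorSeriesZero, h,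
    iteratedDeriv_sub hz.contDiffAt analyticAt_eulerGen.contDiffAt, sub_div,
    ← coeff_taylorSeriesZero, taylorSeriesZero_mul (by fun_prop) analyticAt_bernoulliGen,
    taylorSeriesZero_id, PowerSeries.coeff_succ_X_mul, coeff_taylorSeriesZero,
    iteratedDeriv_bernoulliGen, eulerCoeff]

lemma harmonicLogCoeff_eq (n : ℕ) :
    harmonicLogCoeff n = -((bernoulli' n / n.factorial : ℚ) : ℂ) := by
  rw [harmonicLogCoeff, coeff_taylorSeriesZero, iteratedDeriv_fun_neg, neg_div,
    iteratedDeriv_bernoulliGen]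

lemma hasLogPowExpansion_harmonicGen :
    HasLogPowExpansion (fun t => (harmonicGen t : ℂ)) harmonicCoeff harmonicLogCoeff where
  locallyIntegrableOn :=
    (Complex.continuous_ofReal.comp_continuousOn continuousOn_harmonicGen).locallyIntegrableOn
      measurableSet_Ioi
  isBigO_atTop a := by
    have h := isBigO_harmonicGen_atTop.trans
      (isLittleO_exp_neg_mul_rpow_atTop zero_lt_one (-a)).isBigO
    exact Asymptotics.IsBigO.of_norm_left (h.norm_left.congr_left fun t => by simp)
  isBigO_zero := isBigO_logPowRemainder (φ := fun z => z * bernoulliGen z - eulerGen z)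
    (ψ := fun z => -bernoulliGen z)
    ((analyticAt_id.mul analyticAt_bernoulliGen).sub analyticAt_eulerGen)
    analyticAt_bernoulliGen.neg fun t ht => harmonicGen_eq ht

/-! ### Zeros of `1/Γ` and the meromorphic continuation -/

lemma inv_Gamma_eq_prod (s : ℂ) (n : ℕ) :
    (Complex.Gamma s)⁻¹ = (∏ k ∈ Finset.range n, (s + k)) * (Complex.Gamma (s + n))⁻¹ := by
  induction n with
  | zero => simp
  | succ n ih =>
    rw [ih, Finset.prod_range_succ, Complex.one_div_Gamma_eq_self_mul_one_div_Gamma_add_one]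
    push_cast
    ring_nf

lemma prod_range_neg_add (n : ℕ) :
    ∏ k ∈ Finset.range n, (-(n : ℂ) + k) = (-1) ^ n * n.factorial := by
  rw [← Finset.prod_range_reflect, ← Finset.prod_range_add_one_eq_factorial]
  push_cast
  rw [← Finset.card_range n, ← Finset.prod_const, Finset.card_range, ← Finset.prod_mul_distrib]
  refine Finset.prod_congr rfl fun k hk => ?_
  have hk' : k + 1 ≤ n := Finset.mem_range.mp hk
  rw [Nat.sub_sub, Nat.cast_sub (by omega)]
  push_cast
  ring

/-- The simple zero of `1 / Γ` at `-n`. -/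
lemma exists_analyticAt_inv_Gamma_eq (n : ℕ) :
    ∃ u : ℂ → ℂ, AnalyticAt ℂ u (-(n : ℂ)) ∧ u (-(n : ℂ)) = (-1) ^ n * n.factorial ∧
      ∀ s, (Complex.Gamma s)⁻¹ = (s + n) * u s := by
  refine ⟨fun s => (∏ k ∈ Finset.range n, (s + k)) * (Complex.Gamma (s + (n + 1 : ℕ)))⁻¹,
    AnalyticAt.mul ?_ ?_, ?_, fun s => ?_⟩
  · exact Finset.analyticAt_fun_prod _ fun k _ => by fun_prop
  · exact (Complex.differentiable_one_div_Gamma.comp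
      (differentiable_id.add_const ((n + 1 : ℕ) : ℂ))).analyticAt _
  · simp [prod_range_neg_add]
  · rw [inv_Gamma_eq_prod s (n + 1), Finset.prod_range_succ]
    ring

/-- The meromorphic continuation of the harmonic Euler sum, up to its values at the poles. -/
noncomputable def harmonicContinuation (s : ℂ) : ℂ :=
  (Complex.Gamma s)⁻¹
    * mellinExtension (fun t => (harmonicGen t : ℂ)) harmonicCoeff harmonicLogCoeff s

lemma meromorphicOn_harmonicContinuation : MeromorphicOn harmonicContinuation Set.univ :=
  fun s _ => (Complex.differentiable_one_div_Gamma.analyticAt s).meromorphicAt.mul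
    (hasLogPowExpansion_harmonicGen.meromorphicAt_mellinExtension s)

lemma lseriesHasSum_harmonicContinuation {s : ℂ} (hs : 1 < s.re) :
    LSeriesHasSum (fun n : ℕ => ((harmonic n : ℚ) : ℂ)) s (harmonicContinuation s) := by
  rw [harmonicContinuation, ← hasLogPowExpansion_harmonicGen.mellin_eq_mellinExtension hs]
  exact hasSum_mellin_harmonicGen hs

lemma MeromorphicNFAt.eventuallyEq_of_analyticAt {f g : ℂ → ℂ} {x : ℂ} (hf : MeromorphicNFAt f x)
    (hg : AnalyticAt ℂ g x) (h : f =ᶠ[nhdsWithin x {x}ᶜ] g) : f =ᶠ[nhds x] g :=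
  (hf.eventuallyEq_nhdsNE_iff_eventuallyEq_nhds hg.meromorphicNFAt).1 h

lemma isOpen_one_lt_re : IsOpen {z : ℂ | 1 < z.re} :=
  isOpen_lt continuous_const Complex.continuous_re

/-- Ensures that passing to the normal form leaves the values on `Re s > 1` unchanged. -/
lemma analyticAt_harmonicContinuation {s : ℂ} (hs : 1 < s.re) :
    AnalyticAt ℂ harmonicContinuation s := by
  have hs' : 2 - ((1 : ℕ) : ℝ) < s.re := by push_cast; linarith
  refine (Complex.differentiable_one_div_Gamma.analyticAt s).mul (AnalyticAt.congr ?_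
    (hasLogPowExpansion_harmonicGen.eventually_mellinExtension_eq 1 hs').symm)
  have hne : s + (0 : ℕ) - 1 ≠ 0 := by
    intro h
    have := congrArg Complex.re h
    simp at this
    linarith
  refine (hasLogPowExpansion_harmonicGen.analyticAt_mellin_remainder 1 hs').add ?_
  simp only [Finset.sum_range_one]
  have hl : AnalyticAt ℂ (fun z : ℂ => z + (0 : ℕ) - 1) s := by fun_prop
  exact (analyticAt_const.div hl hne).sub (analyticAt_const.div (hl.pow 2) (pow_ne_zero 2 hne))

lemma isHarmonicEulerContinuation_toMeromorphicNFOn :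
    IsHarmonicEulerContinuation (toMeromorphicNFOn harmonicContinuation Set.univ) where
  meromorphicNFOn := meromorphicNFOn_toMeromorphicNFOn _ _
  hasSum s hs := by
    have h := meromorphicNFOn_toMeromorphicNFOn harmonicContinuation Set.univ (Set.mem_univ s)
    have heq := h.eventuallyEq_of_analyticAt (analyticAt_harmonicContinuation hs)
      (meromorphicOn_harmonicContinuation.toMeromorphicNFOn_eq_self_on_nhdsNE
        (Set.mem_univ s))
    rw [heq.eq_of_nhds]
    exact lseriesHasSum_harmonicContinuation hs

/-! ### Uniqueness of the continuation -/

/-- Identity theorem for meromorphic functions on the plane in normal form. -/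
lemma MeromorphicNFOn.eq_of_eventuallyEq {f g : ℂ → ℂ} (hf : MeromorphicNFOn f Set.univ)
    (hg : MeromorphicNFOn g Set.univ) {x : ℂ} (h : f =ᶠ[nhds x] g) : f = g := by
  have hfg : MeromorphicOn (f - g) Set.univ := hf.meromorphicOn.sub hg.meromorphicOn
  have htop : meromorphicOrderAt (f - g) x = ⊤ := by
    rw [meromorphicOrderAt_eq_top_iff]
    filter_upwards [h.filter_mono nhdsWithin_le_nhds] with z hz
    simp [hz]
  ext z
  have hz : meromorphicOrderAt (f - g) z = ⊤ := by
    by_contra hne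
    exact hfg.meromorphicOrderAt_ne_top_of_isPreconnected isPreconnected_univ (Set.mem_univ z)
      (Set.mem_univ x) hne htop
  rw [meromorphicOrderAt_eq_top_iff] at hz
  refine (((hf (Set.mem_univ z)).eventuallyEq_nhdsNE_iff_eventuallyEq_nhds
    (hg (Set.mem_univ z))).1 ?_).eq_of_nhds
  filter_upwards [hz] with w hw
  exact sub_eq_zero.1 hw

lemma IsHarmonicEulerContinuation.unique {f g : ℂ → ℂ} (hf : IsHarmonicEulerContinuation f)
    (hg : IsHarmonicEulerContinuation g) : f = g := by
  refine hf.meromorphicNFOn.eq_of_eventuallyEq hg.meromorphicNFOn (x := 2) ?_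
  filter_upwards [isOpen_one_lt_re.mem_nhds (by simp : (1 : ℝ) < (2 : ℂ).re)] with s hs
  exact (hf.hasSum s hs).unique (hg.hasSum s hs)

lemma harmonicEulerSum_eq :
    harmonicEulerSum = toMeromorphicNFOn harmonicContinuation Set.univ :=
  (Classical.epsilon_spec ⟨_, isHarmonicEulerContinuation_toMeromorphicNFOn⟩ :
    IsHarmonicEulerContinuation harmonicEulerSum).unique
      isHarmonicEulerContinuation_toMeromorphicNFOn

/-! ### Values at negative integers and the conclusion -/

/-- The harmonic Euler sum is regular at `-n` if the coefficient of `t ^ n log t` vanishes. -/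
lemma harmonicEulerSum_neg {n : ℕ} (hn : harmonicLogCoeff (n + 1) = 0) :
    AnalyticAt ℂ harmonicEulerSum (-(n : ℂ)) ∧
      harmonicEulerSum (-(n : ℂ)) = (-1) ^ n * n.factorial * harmonicCoeff (n + 1) := by
  obtain ⟨g, hg, hge⟩ := hasLogPowExpansion_harmonicGen.exists_analyticAt_mellinExtension_eq n
  obtain ⟨u, hu, hun, hue⟩ := exists_analyticAt_inv_Gamma_eq n
  have hG : AnalyticAt ℂ (fun s => u s * ((s + n) * g s + harmonicCoeff (n + 1))) (-(n : ℂ)) :=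
    hu.mul ((AnalyticAt.mul (by fun_prop) hg).add analyticAt_const)
  have heq : harmonicEulerSum =ᶠ[nhds (-(n : ℂ))]
      fun s => u s * ((s + n) * g s + harmonicCoeff (n + 1)) := by
    rw [harmonicEulerSum_eq]
    -- Away from `-n` the factor `s + n` of `1/Γ` cancels the remaining simple pole; the normal form
    -- extends the equality to the point itself.
    refine MeromorphicNFAt.eventuallyEq_of_analyticAt
      (meromorphicNFOn_toMeromorphicNFOn harmonicContinuation Set.univ (Set.mem_univ _)) hG ?_
    refine (meromorphicOn_harmonicContinuation.toMeromorphicNFOn_eq_self_on_nhdsNE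
        (Set.mem_univ _)).trans ?_
    filter_upwards [hge.filter_mono nhdsWithin_le_nhds, self_mem_nhdsWithin] with s hs hne
    have hne' : s + n ≠ 0 := fun h => hne (eq_neg_of_add_eq_zero_left h)
    rw [harmonicContinuation, hs, hue, hn]
    field_simp
    ring
  refine ⟨hG.congr heq.symm, ?_⟩
  rw [heq.eq_of_nhds]
  simp [hun]

lemma harmonicEulerSum_neg_two_mul {m : ℕ} (hm : 1 ≤ m) :
    AnalyticAt ℂ harmonicEulerSum (-2 * (m : ℂ)) ∧
      harmonicEulerSum (-2 * (m : ℂ))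
        = ((bernoulli (2 * m) : ℚ) : ℂ) - ((2 * m).factorial : ℂ) * eulerCoeff (2 * m + 1) := by
  have hlog : harmonicLogCoeff (2 * m + 1) = 0 := by
    rw [harmonicLogCoeff_eq, bernoulli'_eq_zero_of_odd (by simp) (by omega)]
    simp
  have h := harmonicEulerSum_neg hlog
  have hcast : -((2 * m : ℕ) : ℂ) = -2 * (m : ℂ) := by push_cast; ring
  rw [hcast] at h
  refine ⟨h.1, h.2.trans ?_⟩
  have hfac : ((2 * m).factorial : ℂ) ≠ 0 := by exact_mod_cast (2 * m).factorial_ne_zero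
  rw [harmonicCoeff_succ, bernoulli_eq_bernoulli'_of_ne_one (by omega)]
  push_cast
  rw [pow_mul, neg_one_sq, one_pow]
  field_simp

lemma riemannZeta_one_sub_two_mul {m : ℕ} (hm : 1 ≤ m) :
    riemannZeta (1 - 2 * (m : ℂ)) = -((bernoulli (2 * m) : ℚ) : ℂ) / (2 * m) := by
  have h := riemannZeta_neg_nat_eq_bernoulli' (2 * m - 1)
  have h1 : 2 * m - 1 + 1 = 2 * m := by omega
  rw [h1, Nat.cast_sub (by omega), ← bernoulli_eq_bernoulli'_of_ne_one (by omega)] at h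
  push_cast at h
  rw [neg_sub, sub_add_cancel] at h
  exact h

theorem corollary1 :
    (∃! h : ℂ → ℂ, IsHarmonicEulerContinuation h) ∧
    AnalyticAt ℂ eulerGen 0 ∧
    (∀ n : ℕ, eulerCoeff n = (bernoulliConvolution n : ℂ)) ∧
    ∀ m : ℕ, 1 ≤ m →
      AnalyticAt ℂ harmonicEulerSum (-2 * (m : ℂ)) ∧
      ((2 * m).factorial : ℂ) * eulerCoeff (2 * m + 1)
        = harmonicEulerSum (-2 * (m : ℂ)) - riemannZeta (1 - 2 * (m : ℂ)) ∧
      harmonicEulerSum (-2 * (m : ℂ)) - riemannZeta (1 - 2 * (m : ℂ))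
        = 1 / 2 * ((bernoulli (2 * m) : ℚ) : ℂ) * (1 + 1 / (2 * (m : ℂ))) := by
  refine ⟨⟨_, isHarmonicEulerContinuation_toMeromorphicNFOn, fun g hg =>
    hg.unique isHarmonicEulerContinuation_toMeromorphicNFOn⟩, analyticAt_eulerGen, eulerCoeff_eq,
    fun m hm => ?_⟩
  obtain ⟨han, hval⟩ := harmonicEulerSum_neg_two_mul hm
  have hA : ((2 * m).factorial : ℂ) * eulerCoeff (2 * m + 1)
      = 1 / 2 * ((bernoulli (2 * m) : ℚ) : ℂ) * (1 + 1 / (2 * (m : ℂ))) := by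
    rw [eulerCoeff_eq]
    have h := congrArg (Rat.cast : ℚ → ℂ) (factorial_mul_bernoulliConvolution hm)
    push_cast at h
    exact h
  have hm0 : (m : ℂ) ≠ 0 := by exact_mod_cast (by omega : m ≠ 0)
  have hh : harmonicEulerSum (-2 * (m : ℂ)) - riemannZeta (1 - 2 * (m : ℂ))
      = 1 / 2 * ((bernoulli (2 * m) : ℚ) : ℂ) * (1 + 1 / (2 * (m : ℂ))) := by
    -- With `X = B_(2m) (1 + 1/(2m))` the claim becomes `X - X/2 = X/2`.
    rw [hval, hA, riemannZeta_one_sub_two_mul hm]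
    field_simp
    ring
  exact ⟨han, hA.trans hh.symm, hh⟩
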